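/- Let $n$ be a natural number, let $g:\mathbb{R}\to\mathbb{R}$ be a (finite) convex function with $g(0)=0$, and let $a\in\mathbb{R}^n$ with $a_i>0$ for all $i\in[n]=\{1,\dots,n\}$. Let $$\mathcal{Q}_1=\Big\{(t,x,z)\in\mathbb{R}\times\mathbb{R}^n\times\{0,1\}^n:\ t\ge g\Big(\sum_{i=1}^n a_ix_i\Big),\ x_i\ge 0 \text{ and } x_i(1-z_i)=0\ \text{ for all } i\in[n]\Big\}.$$ Let $g^\pi:\mathbb{R}^2\to\mathbb{R}\cup\{+\infty\}$ denote the perspective function of $g$: $g^\pi(v,s)=s\,g(v/s)$ if $s>0$; $g^\pi(v,0)=\sup_{w\in\mathbb{R}}\,(g(w+v)-g(w))$, the recession function of $g$ at $v$; and $g^\pi(v,s)=+\infty$ if $s<0$. Then a point $(t,x,z)\in\mathbb{R}\times\mathbb{R}^n\times\mathbb{R}^n$ belongs to the closure of the convex hull of $\mathcal{Q}_1$ if and only if $x\ge 0$ and there exists $\lambda\in\mathbb{R}^n$ such that $$t\ge\sum_{i=1}^n g^\pi(a_ix_i,\lambda_i),\qquad \lambda_i\le z_i\le 1\ \text{ for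 all } i\in[n],\qquad \lambda\ge 0,\ \ \sum_{i=1}^n\lambda_i\le 1.$$ -/

import Mathlib

noncomputable section

/-- The mixed-integer set with indicator variables attached to `f` and to the set `I` of indices
of the sign-constrained variables: the triples `(t, x, z)` with `f x ≤ t`, `x i ≥ 0` on `I`,
`z` binary and `x i * (1 - z i) = 0` for all `i`. -/
def indicatorSet {n : ℕ} (f : (Fin n → ℝ) → ℝ) (I : Set (Fin n)) :
    Set (ℝ × (Fin n → ℝ) × (Fin n → ℝ)) :=
  {p | f p.2.1 ≤ p.1 ∧ (∀ i ∈ I, 0 ≤ p.2.1 i) ∧ (∀ i, p.2.2 i = 0 ∨ p.2.2 i = 1) ∧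
    ∀ i, p.2.1 i * (1 - p.2.2 i) = 0}

/-- The indicator set of the rank-one function `x ↦ g (∑ i, a i * x i)`. -/
def rankOneSet {n : ℕ} (g : ℝ → ℝ) (a : Fin n → ℝ) (I : Set (Fin n)) :
    Set (ℝ × (Fin n → ℝ) × (Fin n → ℝ)) :=
  indicatorSet (fun x => g (∑ i, a i * x i)) I

/-- The recession function of a finite convex function `g`, with values in the extended reals:
`v ↦ sup_w (g (w + v) - g w)`. It may take the value `⊤`, and never takes the value `⊥`. -/
def recessionFun (g : ℝ → ℝ) (v : ℝ) : EReal :=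
  ⨆ w : ℝ, ((g (w + v) - g w : ℝ) : EReal)

/-- The perspective function of a finite convex function `g`, with values in the extended reals:
`s * g (v / s)` for `s > 0`, the recession function of `g` at `v` for `s = 0`,
and `⊤` for `s < 0`. -/
def perspective (g : ℝ → ℝ) (v s : ℝ) : EReal :=
  if 0 < s then ((s * g (v / s) : ℝ) : EReal)
  else if s = 0 then recessionFun g v
  else ⊤

/-- The perspective never takes the value `⊥`, so sums of its values are meaningful. -/
theorem perspective_ne_bot (g : ℝ → ℝ) (v s : ℝ) : perspective g v s ≠ ⊥ := by
  unfold perspective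
  split_ifs
  · exact EReal.coe_ne_bot _
  · have h : ((g (0 + v) - g 0 : ℝ) : EReal) ≤ recessionFun g v :=
      le_iSup (fun w : ℝ => ((g (w + v) - g w : ℝ) : EReal)) 0
    exact ne_bot_of_le_ne_bot (EReal.coe_ne_bot _) h
  · exact top_ne_bot

end

/-!
The closed convex hull of the indicator set of `x ↦ g (∑ i, a i * x i)` on the nonnegative orthant.

A finite convex function has a touching affine minorant at every point, so for `s ≥ 0` the
perspective of `g` at `(v, s)` is controlled by the linear forms `m * v + b * s` with `(m, b)` an
affine minorant of `g` (`perspective_le_of_forall_affineMinorant`). Replacing the perspectives by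
these forms, with the minorants chosen independently for each coordinate, turns the extended
formulation into an intersection of closed half-spaces, `extendedSet`. It is closed and convex, and
so is its projection, because the multipliers `l` stay in a compact cube. The projection contains
the indicator set, with `l i` proportional to `a i * x i`, hence also its closed convex hull. The
linear inequalities give back the bound on the sum of perspectives by
`EReal.sum_le_of_forall_choice`.

Conversely, multipliers `l` describe a random choice of at most one index, `i` having probability
`l i`. Placing all of the mass `x i / l i` on the chosen coordinate exhibits a point of the convex
hull (`multiplier_point_mem_convexHull`). The coordinates with `l i = 0`, where the perspective is
the recession function, are then restored one at a time: along `(r, x i * e_i, 0)`, with `r` the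
recession value, the closed convex hull contains a ray, so this is a direction of recession
(`add_mem_of_forall_add_nsmul_mem`).
-/

/-! ### Affine minorants and the perspective -/

theorem ConvexOn.exists_subgradient {g : ℝ → ℝ} (hg : ConvexOn ℝ Set.univ g) (u : ℝ) :
    ∃ m : ℝ, ∀ w, m * (w - u) + g u ≤ g w := by
  have hu : u ∈ interior (Set.univ : Set ℝ) := by simp
  refine ⟨derivWithin g (Set.Ioi u) u, fun w => ?_⟩
  rcases lt_trichotomy u w with h | rfl | h
  · have := hg.rightDeriv_le_slope_of_mem_interior hu (Set.mem_univ w) h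
    rw [slope_def_field, le_div_iff₀ (sub_pos.2 h)] at this
    linarith
  · simp
  · have := (hg.slope_le_leftDeriv_of_mem_interior (Set.mem_univ w) hu h).trans
      (hg.leftDeriv_le_rightDeriv_of_mem_interior hu)
    rw [slope_def_field, div_le_iff₀ (sub_pos.2 h)] at this
    linarith

/-- The affine minorants of `g`: the pairs `(m, b)` with `m * w + b ≤ g w` for all `w`. -/
abbrev AffineMinorant (g : ℝ → ℝ) : Type :=
  {q : ℝ × ℝ // ∀ w, q.1 * w + q.2 ≤ g w}

theorem ConvexOn.exists_affineMinorant_eq {g : ℝ → ℝ} (hg : ConvexOn ℝ Set.univ g) (u : ℝ) :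
    ∃ q : AffineMinorant g, q.1.1 * u + q.1.2 = g u := by
  obtain ⟨m, hm⟩ := hg.exists_subgradient u
  exact ⟨⟨(m, g u - m * u), fun w => by linarith [hm w]⟩, by simp⟩

/-- For `s ≥ 0` the perspective is at most the supremum of the linear forms
`(v, s) ↦ m * v + b * s` given by the affine minorants `(m, b)`. For `s > 0` a minorant touching
`g` at `v / s` attains the value; for `s = 0`, the slope `m` of a minorant touching `g` at `w + v`
satisfies `g (w + v) - g w ≤ m * v`. -/
theorem perspective_le_of_forall_affineMinorant {g : ℝ → ℝ} (hg : ConvexOn ℝ Set.univ g)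
    {v s r : ℝ} (hs : 0 ≤ s) (h : ∀ q : AffineMinorant g, q.1.1 * v + q.1.2 * s ≤ r) :
    perspective g v s ≤ (r : EReal) := by
  rcases hs.eq_or_lt with rfl | hs
  · simp only [perspective, lt_irrefl, if_false, if_true, recessionFun]
    refine iSup_le fun w => EReal.coe_le_coe_iff.2 ?_
    obtain ⟨q, hq⟩ := hg.exists_affineMinorant_eq (w + v)
    linarith [h q, q.2 w]
  · simp only [perspective, hs, if_true]
    obtain ⟨q, hq⟩ := hg.exists_affineMinorant_eq (v / s)
    have := h q
    rw [EReal.coe_le_coe_iff, ← hq]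
    convert this using 1
    field_simp

/-! ### Finite sums in the extended reals -/

theorem EReal.sum_ne_bot {ι : Type*} {p : ι → EReal} (hbot : ∀ i, p i ≠ ⊥) (s : Finset ι) :
    ∑ i ∈ s, p i ≠ ⊥ := by
  classical
  induction s using Finset.induction_on with
  | empty => simp
  | insert j s hj ih =>
    rw [Finset.sum_insert hj]
    exact EReal.add_ne_bot_iff.2 ⟨hbot j, ih⟩

/-- A sum of suprema is bounded by `t` as soon as every sum of independently chosen terms is. -/
theorem EReal.sum_le_of_forall_choice {ι κ : Type*} [Nonempty κ] (f : ι → κ → ℝ) (p : ι → EReal)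
    (hbot : ∀ i, p i ≠ ⊥) (hp : ∀ i (r : ℝ), (∀ k, f i k ≤ r) → p i ≤ r) (s : Finset ι) (t : ℝ)
    (h : ∀ c : ι → κ, ∑ i ∈ s, f i (c i) ≤ t) : ∑ i ∈ s, p i ≤ t := by
  classical
  induction s using Finset.induction_on generalizing t with
  | empty =>
    have := h fun _ => Classical.arbitrary κ
    simpa using this
  | insert i s hi ih =>
    have key : ∀ k, ∑ j ∈ s, p j ≤ ((t - f i k : ℝ) : EReal) := fun k => by
      refine ih _ fun c => ?_
      have := h (Function.update c i k)
      rw [Finset.sum_insert hi, Function.update_self] at this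
      have e : ∑ j ∈ s, f j (Function.update c i k j) = ∑ j ∈ s, f j (c j) :=
        Finset.sum_congr rfl fun j hj => by
          rw [Function.update_of_ne (ne_of_mem_of_not_mem hj hi)]
      linarith
    rw [Finset.sum_insert hi]
    generalize hP : ∑ j ∈ s, p j = P at key
    have hP_bot : P ≠ ⊥ := by
      rw [← hP]
      exact EReal.sum_ne_bot hbot s
    have hP_top : P ≠ ⊤ :=
      ne_top_of_le_ne_top (EReal.coe_ne_top _) (key (Classical.arbitrary κ))
    lift P to ℝ using ⟨hP_top, hP_bot⟩
    have := hp i (t - P) fun k => by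
      have := EReal.coe_le_coe_iff.1 (key k)
      linarith
    calc p i + (P : EReal) ≤ ((t - P : ℝ) : EReal) + (P : EReal) := by gcongr
      _ = t := by rw [← EReal.coe_add, _root_.sub_add_cancel]

theorem EReal.exists_real_of_sum_le {ι : Type*} [Fintype ι] {p : ι → EReal}
    (hbot : ∀ i, p i ≠ ⊥) {t : ℝ} (h : ∑ i, p i ≤ (t : EReal)) :
    ∃ r : ι → ℝ, (∀ i, p i = r i) ∧ ∑ i, r i ≤ t := by
  classical
  have htop : ∀ i, p i ≠ ⊤ := fun i hi => by
    rw [← Finset.add_sum_erase _ _ (Finset.mem_univ i), hi,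
      EReal.top_add_of_ne_bot (EReal.sum_ne_bot hbot _)] at h
    exact EReal.coe_ne_top t (top_le_iff.1 h)
  refine ⟨fun i => (p i).toReal, fun i => (EReal.coe_toReal (htop i) (hbot i)).symm, ?_⟩
  have hcoe : ((∑ i, (p i).toReal : ℝ) : EReal) = ∑ i, p i := by
    rw [← Finset.sum_congr rfl fun i _ => EReal.coe_toReal (htop i) (hbot i)]
    exact map_sum (⟨⟨Real.toEReal, EReal.coe_zero⟩, EReal.coe_add⟩ : ℝ →+ EReal) _ _
  rwa [← EReal.coe_le_coe_iff, hcoe]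

/-! ### The linearized extended formulation -/

/-- The extended formulation, with `perspective` replaced by the linear inequalities coming from
one affine minorant of `g` per coordinate. The multipliers `l` are the last component. -/
def extendedSet {n : ℕ} (g : ℝ → ℝ) (a : Fin n → ℝ) :
    Set ((ℝ × (Fin n → ℝ) × (Fin n → ℝ)) × (Fin n → ℝ)) :=
  {p | (∀ i, 0 ≤ p.1.2.1 i) ∧
    (∀ c : Fin n → AffineMinorant g,
      ∑ i, ((c i).1.1 * (a i * p.1.2.1 i) + (c i).1.2 * p.2 i) ≤ p.1.1) ∧
    (∀ i, p.2 i ≤ p.1.2.2 i) ∧ (∀ i, p.1.2.2 i ≤ 1) ∧ (∀ i, 0 ≤ p.2 i) ∧ ∑ i, p.2 i ≤ 1}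

theorem convex_extendedSet {n : ℕ} (g : ℝ → ℝ) (a : Fin n → ℝ) : Convex ℝ (extendedSet g a) := by
  rintro ⟨⟨t, x, z⟩, l⟩ ⟨h1, h2, h3, h4, h5, h6⟩ ⟨⟨t', x', z'⟩, l'⟩ ⟨k1, k2, k3, k4, k5, k6⟩
    u v hu hv huv
  dsimp only at h1 h2 h3 h4 h5 h6 k1 k2 k3 k4 k5 k6
  refine ⟨fun i => ?_, fun c => ?_, fun i => ?_, fun i => ?_, fun i => ?_, ?_⟩ <;>
    simp only [Prod.smul_mk, Prod.mk_add_mk, Pi.add_apply, Pi.smul_apply, smul_eq_mul]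
  · have := h1 i
    have := k1 i
    positivity
  · refine le_trans (le_of_eq ?_)
      (add_le_add (mul_le_mul_of_nonneg_left (h2 c) hu) (mul_le_mul_of_nonneg_left (k2 c) hv))
    rw [Finset.mul_sum, Finset.mul_sum, ← Finset.sum_add_distrib]
    exact Finset.sum_congr rfl fun i _ => by ring
  · have := h3 i
    have := k3 i
    gcongr
  · nlinarith [mul_le_mul_of_nonneg_left (h4 i) hu, mul_le_mul_of_nonneg_left (k4 i) hv]
  · have := h5 i
    have := k5 i
    positivity
  · rw [Finset.sum_add_distrib, ← Finset.mul_sum, ← Finset.mul_sum]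
    nlinarith [mul_le_mul_of_nonneg_left h6 hu, mul_le_mul_of_nonneg_left k6 hv]

theorem isClosed_extendedSet {n : ℕ} (g : ℝ → ℝ) (a : Fin n → ℝ) :
    IsClosed (extendedSet g a) := by
  simp only [extendedSet, Set.ofPred_and, Set.ofPred_forall]
  refine (isClosed_iInter fun i => ?_).inter <| (isClosed_iInter fun c => ?_).inter <|
    (isClosed_iInter fun i => ?_).inter <| (isClosed_iInter fun i => ?_).inter <|
    (isClosed_iInter fun i => ?_).inter ?_ <;> exact isClosed_le (by fun_prop) (by fun_prop)

/-- The multipliers range over a compact cube, so projecting them out preserves closedness. -/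
theorem isClosed_fst_image_extendedSet {n : ℕ} (g : ℝ → ℝ) (a : Fin n → ℝ) :
    IsClosed (Prod.fst '' extendedSet g a) := by
  have : CompactSpace (Set.Icc (0 : Fin n → ℝ) 1) := isCompact_iff_compactSpace.1 isCompact_Icc
  have hc := isClosedMap_fst_of_compactSpace (X := ℝ × (Fin n → ℝ) × (Fin n → ℝ))
    (Y := Set.Icc (0 : Fin n → ℝ) 1) _ ((isClosed_extendedSet g a).preimage
      (f := fun p : (ℝ × (Fin n → ℝ) × (Fin n → ℝ)) × Set.Icc (0 : Fin n → ℝ) 1 => (p.1, p.2.1))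
      (by fun_prop))
  convert hc using 1
  ext p
  constructor
  · rintro ⟨⟨p, l⟩, h, rfl⟩
    exact ⟨(p, ⟨l, fun i => h.2.2.2.2.1 i, fun i => (h.2.2.1 i).trans (h.2.2.2.1 i)⟩), h, rfl⟩
  · rintro ⟨⟨p, l⟩, h, rfl⟩
    exact ⟨(p, l.1), h, rfl⟩

/-- With `S = ∑ j, a j * x j > 0`, the multipliers `a i * x i / S` turn the sum of the affine
bounds into a convex combination of bounds on `g S`. For `S = 0` all multipliers vanish, by
`0 / 0 = 0`, and the bound reads `0 = g 0 ≤ t`. -/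
theorem rankOneSet_subset_fst_image_extendedSet {n : ℕ} {g : ℝ → ℝ} (hg0 : g 0 = 0)
    {a : Fin n → ℝ} (ha : ∀ i, 0 < a i) :
    rankOneSet g a Set.univ ⊆ Prod.fst '' extendedSet g a := by
  rintro ⟨t, x, z⟩ ⟨ht, hx, hz, hxz⟩
  dsimp only at ht hx hz hxz
  replace hx : ∀ i, 0 ≤ x i := fun i => hx i trivial
  have hax : ∀ i, 0 ≤ a i * x i := fun i => mul_nonneg (ha i).le (hx i)
  have hz0 : ∀ i, 0 ≤ z i := fun i => by rcases hz i with h | h <;> simp [h]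
  have hz1 : ∀ i, z i ≤ 1 := fun i => by rcases hz i with h | h <;> simp [h]
  set S := ∑ i, a i * x i with hS
  have hS0 : 0 ≤ S := Finset.sum_nonneg fun i _ => hax i
  refine ⟨((t, x, z), fun i => a i * x i / S), ⟨hx, fun c => ?_, fun i => ?_, hz1, fun i => ?_, ?_⟩,
    rfl⟩
  · dsimp only
    rcases hS0.eq_or_lt with h0 | hpos
    · have : ∀ i, a i * x i = 0 := fun i =>
        (Finset.sum_eq_zero_iff_of_nonneg fun i _ => hax i).1 (hS.symm.trans h0.symm) i
          (Finset.mem_univ i)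
      simp only [this, zero_div, mul_zero, add_zero, Finset.sum_const_zero]
      rwa [← h0, hg0] at ht
    · calc ∑ i, ((c i).1.1 * (a i * x i) + (c i).1.2 * (a i * x i / S))
          = ∑ i, a i * x i / S * ((c i).1.1 * S + (c i).1.2) :=
            Finset.sum_congr rfl fun i _ => by field_simp
        _ ≤ ∑ i, a i * x i / S * g S :=
            Finset.sum_le_sum fun i _ =>
              mul_le_mul_of_nonneg_left ((c i).2 S) (div_nonneg (hax i) hS0)
        _ = g S := by rw [← Finset.sum_mul, ← Finset.sum_div, ← hS, div_self hpos.ne', one_mul]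
        _ ≤ t := ht
  · dsimp only
    rcases mul_eq_zero.1 (hxz i) with h | h
    · simpa [h] using hz0 i
    · rw [← sub_eq_zero.1 h]
      exact div_le_one_of_le₀ (Finset.single_le_sum (fun i _ => hax i) (Finset.mem_univ i)) hS0
  · exact div_nonneg (hax i) hS0
  · dsimp only
    rw [← Finset.sum_div, ← hS]
    exact div_self_le_one S

/-! ### Recession directions and convex combinations -/

/-- If a closed convex set contains the ray `e + k • d`, then `d` is a direction of recession. -/
theorem add_mem_of_forall_add_nsmul_mem {E : Type*} [AddCommGroup E] [Module ℝ E]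
    [TopologicalSpace E] [ContinuousAdd E] [ContinuousSMul ℝ E] {C : Set E} (hC : IsClosed C)
    (hconv : Convex ℝ C) {e d p : E} (hp : p ∈ C) (h : ∀ k : ℕ, e + (k : ℝ) • d ∈ C) :
    p + d ∈ C := by
  have hlim : Filter.Tendsto (fun k : ℕ => (1 - 1 / ((k : ℝ) + 1)) • p + (1 / ((k : ℝ) + 1)) • e + d)
      Filter.atTop (nhds (p + d)) := by
    have h0 := tendsto_one_div_add_atTop_nhds_zero_nat (𝕜 := ℝ)
    have := (((h0.const_sub 1).smul_const p).add (h0.smul_const e)).add_const d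
    simpa using this
  refine hC.mem_of_tendsto hlim (Filter.Eventually.of_forall fun k => ?_)
  have hk : (0 : ℝ) < (k : ℝ) + 1 := by positivity
  have := hconv hp (h (k + 1)) (a := 1 - 1 / ((k : ℝ) + 1)) (b := 1 / ((k : ℝ) + 1))
    (sub_nonneg.2 ((div_le_one hk).2 (by linarith [k.cast_nonneg (α := ℝ)]))) (by positivity)
    (by ring)
  convert this using 1
  rw [smul_add, smul_smul]
  push_cast
  rw [one_div_mul_cancel hk.ne', one_smul, add_assoc]

/-- Telescoping bound: `k` steps of length `v` from the origin increase `g` by at most `k` times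
its recession value at `v`. -/
theorem apply_natCast_mul_le_of_recessionFun_le {g : ℝ → ℝ} (hg0 : g 0 = 0) {v r : ℝ}
    (h : recessionFun g v ≤ (r : EReal)) (k : ℕ) : g (k * v) ≤ k * r := by
  induction k with
  | zero => simp [hg0]
  | succ k ih =>
    have := EReal.coe_le_coe_iff.1 ((le_iSup
      (fun w : ℝ => ((g (w + v) - g w : ℝ) : EReal)) (k * v)).trans h)
    push_cast
    rw [add_one_mul, add_one_mul]
    linarith

/-- The binary indicators may be relaxed to the unit cube, keeping `z i = 1` wherever `x i ≠ 0`: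
the cube with these coordinates fixed is the convex hull of its vertices. -/
theorem mem_convexHull_rankOneSet {n : ℕ} {g : ℝ → ℝ} {a : Fin n → ℝ} {t : ℝ} {x z : Fin n → ℝ}
    (ht : g (∑ i, a i * x i) ≤ t) (hx : ∀ i, 0 ≤ x i) (hz : ∀ i, 0 ≤ z i ∧ z i ≤ 1)
    (hxz : ∀ i, x i ≠ 0 → z i = 1) :
    (t, x, z) ∈ convexHull ℝ (rankOneSet g a Set.univ) := by
  classical
  let F : Fin n → Set ℝ := fun i => if x i = 0 then {0, 1} else {1}
  have hsub : ({t} : Set ℝ) ×ˢ (({x} : Set (Fin n → ℝ)) ×ˢ Set.univ.pi F) ⊆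
      rankOneSet g a Set.univ := by
    rintro ⟨t', x', z'⟩ ⟨rfl, rfl, hz'⟩
    have hz' : ∀ i, z' i ∈ F i := fun i => hz' i trivial
    refine ⟨ht, fun i _ => hx i, fun i => ?_, fun i => ?_⟩ <;>
      · have := hz' i
        by_cases h : x' i = 0 <;> simp_all [F]
  refine convexHull_mono hsub ?_
  rw [convexHull_prod, convexHull_prod, convexHull_pi, convexHull_singleton, convexHull_singleton]
  refine ⟨rfl, rfl, fun i _ => ?_⟩
  change z i ∈ convexHull ℝ (F i)
  by_cases h : x i = 0
  · have hF : F i = {0, 1} := if_pos h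
    rw [hF, convexHull_pair, segment_eq_Icc zero_le_one]
    exact hz i
  · have hF : F i = {1} := if_neg h
    rw [hF, convexHull_singleton]
    exact hxz i h

/-- The disjunctive step: with probability `l i` the point is supported on coordinate `i` with
value `x i / l i`, otherwise `x` vanishes. Coordinates with `l i = 0` contribute nothing, by
`x i / 0 = 0`. Given the chosen index, the remaining indicators are `(z j - l j) / (1 - l j)`. -/
theorem multiplier_point_mem_convexHull {n : ℕ} {g : ℝ → ℝ} (hg0 : g 0 = 0) {a : Fin n → ℝ}
    {x z l : Fin n → ℝ} {δ : ℝ} (hδ : 0 ≤ δ) (hx : ∀ i, 0 ≤ x i) (hlz : ∀ i, l i ≤ z i)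
    (hz : ∀ i, z i ≤ 1) (hl : ∀ i, 0 ≤ l i) (hl1 : ∑ i, l i ≤ 1) :
    (∑ i, l i * g (a i * x i / l i) + δ, (fun i => l i * (x i / l i)), z) ∈
      convexHull ℝ (rankOneSet g a Set.univ) := by
  classical
  let q : Fin n → ℝ := fun j => (z j - l j) / (1 - l j)
  have hq : ∀ j, 0 ≤ q j ∧ q j ≤ 1 := fun j =>
    ⟨div_nonneg (by linarith [hlz j]) (by linarith [hlz j, hz j]),
      div_le_one_of_le₀ (by linarith [hz j]) (by linarith [hlz j, hz j])⟩
  -- If `l j = 1` then `z j = 1` and the value `q j = 0 / 0` carries no weight.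
  have hqz : ∀ j, l j + (1 - l j) * q j = z j := fun j => by
    by_cases h : 1 - l j = 0
    · rw [h, zero_mul]
      linarith [hlz j, hz j]
    · rw [mul_div_cancel₀ _ h]
      ring
  let P : Option (Fin n) → ℝ × (Fin n → ℝ) × (Fin n → ℝ) := fun o =>
    o.elim (δ, 0, q) fun i =>
      (g (a i * x i / l i) + δ, Pi.single i (x i / l i), Function.update q i 1)
  let w : Option (Fin n) → ℝ := fun o => o.elim (1 - ∑ i, l i) l
  have hP : ∀ o, P o ∈ convexHull ℝ (rankOneSet g a Set.univ) := by
    rintro (_ | i)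
    · exact mem_convexHull_rankOneSet (by simpa [hg0] using hδ) (fun _ => le_rfl) hq (by simp)
    · refine mem_convexHull_rankOneSet ?_ (fun j => ?_) (fun j => ?_) (fun j hj => ?_)
      · simp only [Pi.single_apply, mul_ite, mul_zero, Finset.sum_ite_eq', Finset.mem_univ,
          if_true, ← mul_div_assoc]
        linarith
      · rw [Pi.single_apply]
        split_ifs
        · exact div_nonneg (hx i) (hl i)
        · exact le_rfl
      · rw [Function.update_apply]
        split_ifs
        · simp
        · exact hq j
      · have : j = i := by
          by_contra h
          exact hj (Pi.single_eq_of_ne h _)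
        rw [this, Function.update_self]
  have hmem := (convex_convexHull ℝ (rankOneSet g a Set.univ)).sum_mem (t := Finset.univ) (w := w)
    (z := P) (by rintro (_ | i) -; exacts [sub_nonneg.2 hl1, hl i])
    (by rw [Fintype.sum_option]; simp [w]) (fun o _ => hP o)
  convert hmem using 1
  rw [Fintype.sum_option]
  refine Prod.ext ?_ (Prod.ext (funext fun j => ?_) (funext fun j => ?_))
  · simp only [P, w, Option.elim, Prod.fst_add, Prod.smul_fst, Prod.fst_sum, smul_eq_mul, mul_add,
      Finset.sum_add_distrib, ← Finset.sum_mul]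
    ring
  · simp [P, w, Prod.snd_sum, Prod.fst_sum, Pi.single_apply]
  · simp only [P, w, Option.elim, Prod.snd_add, Prod.smul_snd, Prod.snd_sum, Pi.add_apply,
      Pi.smul_apply, Finset.sum_apply, smul_eq_mul, Function.update_apply]
    have e : ∀ i, l i * (if j = i then 1 else q j) = l i * q j + if j = i then l i * (1 - q j) else 0 :=
      fun i => by split_ifs <;> ring
    simp only [e, Finset.sum_add_distrib, ← Finset.sum_mul, Finset.sum_ite_eq, Finset.mem_univ,
      if_true]
    rw [← hqz j]
    ring

/-! ### The closed convex hull -/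

theorem corollary1 {n : ℕ} (g : ℝ → ℝ) (hg : ConvexOn ℝ Set.univ g) (hg0 : g 0 = 0)
    (a : Fin n → ℝ) (ha : ∀ i, 0 < a i) (t : ℝ) (x z : Fin n → ℝ) :
    (t, x, z) ∈ closure (convexHull ℝ (rankOneSet g a Set.univ)) ↔
      (∀ i, 0 ≤ x i) ∧
      ∃ l : Fin n → ℝ,
        ∑ i, perspective g (a i * x i) (l i) ≤ (t : EReal) ∧
        (∀ i, l i ≤ z i ∧ z i ≤ 1) ∧
        (∀ i, 0 ≤ l i) ∧ ∑ i, l i ≤ 1 := by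
  constructor
  · intro h
    have hsub : closure (convexHull ℝ (rankOneSet g a Set.univ)) ⊆ Prod.fst '' extendedSet g a :=
      closure_minimal (convexHull_min (rankOneSet_subset_fst_image_extendedSet hg0 ha)
        ((convex_extendedSet g a).linear_image (LinearMap.fst ℝ _ _)))
        (isClosed_fst_image_extendedSet g a)
    obtain ⟨⟨p, l⟩, ⟨hx, hc, hlz, hz, hl, hl1⟩, rfl⟩ := hsub h
    have : Nonempty (AffineMinorant g) := ⟨(hg.exists_affineMinorant_eq 0).choose⟩
    exact ⟨hx, l, EReal.sum_le_of_forall_choice _ _ (fun i => perspective_ne_bot g _ _)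
      (fun i r => perspective_le_of_forall_affineMinorant hg (hl i)) Finset.univ t hc,
      fun i => ⟨hlz i, hz i⟩, hl, hl1⟩
  · rintro ⟨hx, l, hsum, hlz, hl, hl1⟩
    obtain ⟨r, hr, hrt⟩ := EReal.exists_real_of_sum_le
      (fun i => perspective_ne_bot g (a i * x i) (l i)) hsum
    set C := closure (convexHull ℝ (rankOneSet g a Set.univ))
    have hCconv : Convex ℝ C := (convex_convexHull ℝ _).closure
    -- The slack `t - ∑ i, r i` is spread over all points of the combination.
    have hpoint := subset_closure (multiplier_point_mem_convexHull (a := a) hg0 (sub_nonneg.2 hrt)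
      hx (fun i => (hlz i).1) (fun i => (hlz i).2) hl hl1)
    -- The recession directions that restore the coordinates with `l i = 0`.
    let d : Fin n → ℝ × (Fin n → ℝ) × (Fin n → ℝ) := fun i =>
      if l i = 0 then (r i, Pi.single i (x i), 0) else 0
    have hd : ∀ i, ∀ p ∈ C, p + d i ∈ C := fun i p hp => by
      by_cases h : l i = 0
      · refine add_mem_of_forall_add_nsmul_mem isClosed_closure hCconv
          (e := (0, 0, Pi.single i 1)) hp fun k => subset_closure (subset_convexHull ℝ _ ?_)
        have hri : recessionFun g (a i * x i) ≤ (r i : EReal) := by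
          rw [← hr i, perspective, h]
          simp
        have hk := apply_natCast_mul_le_of_recessionFun_le hg0 hri k
        refine ⟨?_, fun j _ => ?_, fun j => ?_, fun j => ?_⟩
        · simpa [d, h, Pi.single_apply, mul_left_comm] using hk
        · have := hx i
          simp only [d, h, if_true, Prod.snd_add, Prod.fst_add, Prod.smul_snd, Prod.smul_fst,
            zero_add, Pi.smul_apply, Pi.single_apply, smul_eq_mul]
          split_ifs <;> positivity
        · by_cases hj : j = i <;> simp [d, h, hj]
        · by_cases hj : j = i <;> simp [d, h, hj]
      · simpa [d, h] using hp
    have hall : ∀ s : Finset (Fin n), ∀ p ∈ C, p + ∑ i ∈ s, d i ∈ C := fun s => by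
      induction s using Finset.induction_on with
      | empty => simp
      | insert i s hi ih =>
        intro p hp
        rw [Finset.sum_insert hi, ← add_assoc]
        exact ih _ (hd i p hp)
    convert hall Finset.univ _ hpoint using 1
    refine Prod.ext ?_ (Prod.ext (funext fun j => ?_) (funext fun j => ?_))
    · have e : ∀ i, l i * g (a i * x i / l i) + (d i).1 = r i := fun i => by
        by_cases h : l i = 0
        · simp [d, h]
        · have := hr i
          rw [perspective, if_pos (lt_of_le_of_ne (hl i) (Ne.symm h)), EReal.coe_eq_coe_iff] at this
          simp [d, h, this]
      have := Finset.sum_congr rfl fun i (_ : i ∈ Finset.univ) => e i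
      rw [Finset.sum_add_distrib] at this
      rw [Prod.fst_add, Prod.fst_sum]
      dsimp only
      linarith
    · have e : ∀ i, (d i).2.1 j = if i = j then (if l j = 0 then x j else 0) else 0 := fun i => by
        by_cases hij : i = j
        · subst hij
          by_cases h : l i = 0 <;> simp [d, h]
        · by_cases h : l i = 0 <;> simp [d, h, hij, Ne.symm hij]
      rw [Prod.snd_add, Prod.snd_sum, Prod.fst_add, Prod.fst_sum, Pi.add_apply, Finset.sum_apply]
      simp only [e, Finset.sum_ite_eq', Finset.mem_univ, if_true]
      by_cases h : l j = 0
      · simp [h]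
      · simp [h, mul_div_cancel₀]
    · have e : ∀ i, (d i).2.2 j = 0 := fun i => by
        by_cases h : l i = 0 <;> simp [d, h]
      rw [Prod.snd_add, Prod.snd_sum, Prod.snd_add, Prod.snd_sum, Pi.add_apply, Finset.sum_apply]
      simp [e]
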